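/- Let $\mathbb U=\bigcup_{h\ge 0}\{1,2,3,\dots\}^h$ be the set of finite words over the positive integers, with empty word $\varnothing$; write $u*v$ for concatenation and $v\preceq u$ if $v$ is a prefix of $u$ ($v\prec u$ if moreover $v\neq u$). Let $(T_n)_{n\ge 1}$ be the uniform attachment (UA) process of plane trees on a probability space: $T_1=\{\varnothing\}$ and, for $n\ge 1$, $T_{n+1}=T_n\cup\{V_n*(k_{V_n}(T_n)+1)\}$, where $k_u(t)=|\{j\ge 1: u*j\in t\}|$ is the number of children of $u$ in $t$ and, conditionally given $(T_1,\dots,T_n)$, $V_n$ is uniformly distributed on $T_n$. For $u\in\mathbb U$ let $\theta_uT_n=\{v\in\mathbb U: u*v\in T_n\}$, and for $f:\mathbb U\to[0,\infty)$ and $x>0$ let \[N_x(f)=\Big|\Big\{u\in\mathbb U:\ x\prod_{\varnothing\prec v\preceq u}\tfrac{f(v)}2\ge 1\Big\}\Big|\in\{0,1,2,\dots\}\cup\{\infty\}.\] Proposition. Almost surely, the limit $P_u=\lim_{n\to\infty}|\theta_uT_n|/n$ exists for every $u\in\mathbb U$. Moreover, writing $P=(P_u)_{u\in\mathbb U}$,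 there is a universal constant $c>0$ such that for all real $x\ge 1$ and $y\ge 1$, \[\mathbb P\Big(N_x(P)\ge y\exp\big(c+c\sqrt{\log x}\big)\Big)\le 2e^{-y}.\] -/

import Mathlib

open MeasureTheory Filter Topology
open scoped ENNReal

namespace UniformAttachment

/-- The set `𝕌` of finite words over the positive integers; `[]` is the empty word (the root) and
`u ++ [j]` is the `j`-th child of `u`. -/
abbrev Word : Type := List ℕ+

/-- The subtree `θ_u t = {v | u * v ∈ t}` of `t` stemming from `u`. -/
noncomputable def stemmingSubtree (u : Word) (t : Finset Word) : Finset Word :=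
  t.preimage (fun v => u ++ v) (List.append_right_injective u).injOn

theorem child_injective (u : Word) : Function.Injective (fun j : ℕ+ => u ++ [j]) :=
  fun i j h => by simpa using h

/-- The number `k_u(t)` of children of `u` in `t`, that is, of `j ≥ 1` with `u * j ∈ t`. -/
noncomputable def childCount (u : Word) (t : Finset Word) : ℕ :=
  (t.preimage (fun j : ℕ+ => u ++ [j]) (child_injective u).injOn).card

/-- The tree `t` together with a new last child of `v`, namely `v * (k_v(t) + 1)`. -/
noncomputable def attach (t : Finset Word) (v : Word) : Finset Word :=
  insert (v ++ [Nat.succPNat (childCount v t)]) t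

/-- `(T_n)_{n ≥ 1}` is a uniform attachment process on the probability space `(Ω, μ)`, with
`V_n` the node chosen at step `n` (the values at `n = 0` are irrelevant). -/
structure IsUniformAttachment {Ω : Type*} [MeasurableSpace Ω] (μ : Measure Ω)
    (T : ℕ → Ω → Finset Word) (V : ℕ → Ω → Word) : Prop where
  /-- Each `V_n` is a random variable (with values in a countable discrete space). -/
  measurableSet_eq : ∀ n, 1 ≤ n → ∀ v, MeasurableSet {ω | V n ω = v}
  /-- `T_1` consists of the root only. -/
  init : ∀ ω, T 1 ω = {[]}
  /-- `T_{n+1} = T_n ∪ {V_n * (k_{V_n}(T_n) + 1)}`. -/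
  step : ∀ n, 1 ≤ n → ∀ ω, T (n + 1) ω = attach (T n ω) (V n ω)
  /-- Conditionally given `(T_1, …, T_n)`, the node `V_n` is uniform on `T_n`. -/
  uniform : ∀ n, 1 ≤ n → ∀ t : ℕ → Finset Word, ∀ v ∈ t n,
    μ {ω | (∀ i ∈ Finset.Icc 1 n, T i ω = t i) ∧ V n ω = v} =
      μ {ω | ∀ i ∈ Finset.Icc 1 n, T i ω = t i} / ((t n).card : ℝ≥0∞)

/-- The proportion `|θ_u t| / n` of a subtree, for a tree `t` with `n` nodes. -/
noncomputable def proportion (n : ℕ) (t : Finset Word) (u : Word) : ℝ :=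
  ((stemmingSubtree u t).card : ℝ) / n

/-- The limiting proportion `P_u = lim_n |θ_u t_n| / n` along a sequence of trees. -/
noncomputable def limitProportion (t : ℕ → Finset Word) (u : Word) : ℝ :=
  limUnder atTop (fun n => proportion n (t n) u)

/-- `E_x(f)`, the set of words `u` with `x ∏_{∅ ≺ v ⪯ u} f(v)/2 ≥ 1`. The nonempty prefixes `v`
of `u` are the words `u.take (k + 1)` for `k < u.length`. -/
def competitorSet (x : ℝ) (f : Word → ℝ) : Set Word :=
  {u | 1 ≤ x * ∏ k ∈ Finset.range u.length, f (u.take (k + 1)) / 2}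

/-- `N_x(f) = |E_x(f)|`, possibly infinite. -/
noncomputable def competitorCount (x : ℝ) (f : Word → ℝ) : ℕ∞ :=
  (competitorSet x f).encard

end UniformAttachment

/-! Dropping the factors 1/2, each counted word `u` satisfies `1 ≤ x ^ β * ∏ P_v ^ β` for any `0 < β
≤ 1`, so `N_x(P) ≤ x ^ β * S` with `S = ∑_u ∏_{∅ ≺ v ⪯ u} P_v ^ β`. It remains to bound an
exponential moment of `S`, which is done for its analogue `powerSum` on finite trees.

The tree splits at the first child of its root: the first subtree has uniform size and, given this
size, it and the rest are independent uniform attachment trees (`treeMean_succ_eq`). As `powerSum`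
is affine under this splitting (`powerSum_graft`), its exponential moments satisfy a closed
recursion in the size. The explicit supersolution `growth`, bounded by `exp (2 / β)`, gives a moment
of order `l = exp (-2 / β) / 3` at most 2, uniformly in the size (`treeMean_exp_powerSum_le_two`).

Proportions converge as bounded submartingales (`ae_tendsto_proportion`). Fatou's lemma carries the
moment bound to the limit and Markov's inequality gives the tail. The choice `β = 1 / (1 + √(log
x))` makes `x ^ β / l` at most `exp (4 + 4 * √(log x))`. -/

namespace UniformAttachment

/-! ### Trees reachable by uniform attachment -/

/-- The trees with `n + 1` nodes that the attachment process can reach. -/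
inductive IsRecursiveTree : ℕ → Finset Word → Prop
  | root : IsRecursiveTree 0 {[]}
  | attach {n : ℕ} {t : Finset Word} {v : Word} :
      IsRecursiveTree n t → v ∈ t → IsRecursiveTree (n + 1) (attach t v)

theorem mem_stemmingSubtree {u v : Word} {t : Finset Word} :
    v ∈ stemmingSubtree u t ↔ u ++ v ∈ t := by
  simp [stemmingSubtree]

theorem mem_attach {t : Finset Word} {v w : Word} :
    w ∈ attach t v ↔ w = v ++ [Nat.succPNat (childCount v t)] ∨ w ∈ t := by
  simp [attach]

theorem childCount_attach_of_ne {t : Finset Word} {v w : Word} (h : w ≠ v) :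
    childCount w (attach t v) = childCount w t := by
  unfold childCount
  congr 1
  ext j
  simp only [Finset.mem_preimage, mem_attach]
  constructor
  · rintro (h' | h')
    · exact absurd (List.append_inj_left' h' rfl) h
    · exact h'
  · exact Or.inr

theorem childCount_attach_self {t : Finset Word} {v : Word}
    (h : v ++ [Nat.succPNat (childCount v t)] ∉ t) :
    childCount v (attach t v) = childCount v t + 1 := by
  have : (attach t v).preimage (fun j : ℕ+ => v ++ [j]) (child_injective v).injOn =
      insert (Nat.succPNat (childCount v t))
        (t.preimage (fun j : ℕ+ => v ++ [j]) (child_injective v).injOn) := by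
    ext j
    simp [mem_attach]
  rw [childCount, this, Finset.card_insert_of_notMem (by simpa using h), childCount]

theorem not_mem_of_mem_iff_le {t : Finset Word} {v : Word}
    (h : ∀ j : ℕ+, v ++ [j] ∈ t ↔ (j : ℕ) ≤ childCount v t) :
    v ++ [Nat.succPNat (childCount v t)] ∉ t := by
  rw [h]
  simp

namespace IsRecursiveTree

variable {n : ℕ} {t : Finset Word}

theorem nil_mem (h : IsRecursiveTree n t) : [] ∈ t := by
  induction h with
  | root => simp
  | attach _ _ ih => exact mem_attach.2 (Or.inr ih)

/-- Children are labelled consecutively from 1. This is what makes the node added by `attach`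
genuinely new. -/
theorem child_mem_iff (h : IsRecursiveTree n t) (v : Word) (j : ℕ+) :
    v ++ [j] ∈ t ↔ (j : ℕ) ≤ childCount v t := by
  induction h generalizing v j with
  | root =>
    have : childCount v {[]} = 0 := by
      simp only [childCount, Finset.card_eq_zero]
      ext j
      simp
    simp [this]
  | @attach n t w ht hw ih =>
    have hnew := not_mem_of_mem_iff_le (ih w)
    rw [mem_attach, ih]
    by_cases hv : v = w
    · subst hv
      rw [childCount_attach_self hnew]
      simp only [List.append_cancel_left_eq, List.cons.injEq, and_true, ← PNat.coe_inj,
        Nat.succPNat_coe]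
      omega
    · rw [childCount_attach_of_ne hv]
      constructor
      · rintro (h' | h')
        · exact absurd (List.append_inj_left' h' rfl) hv
        · exact h'
      · exact Or.inr

theorem newChild_not_mem (h : IsRecursiveTree n t) (v : Word) :
    v ++ [Nat.succPNat (childCount v t)] ∉ t :=
  not_mem_of_mem_iff_le (h.child_mem_iff v)

theorem card (h : IsRecursiveTree n t) : t.card = n + 1 := by
  induction h with
  | root => simp
  | attach ht _ ih =>
    rw [UniformAttachment.attach, Finset.card_insert_of_notMem (ht.newChild_not_mem _), ih]

theorem parent_mem (h : IsRecursiveTree n t) {v : Word} {j : ℕ+} (hv : v ++ [j] ∈ t) : v ∈ t := by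
  induction h generalizing v j with
  | root => simp at hv
  | attach ht hw ih =>
    rcases mem_attach.1 hv with h' | h'
    · rw [List.append_inj_left' h' rfl]
      exact mem_attach.2 (Or.inr hw)
    · exact mem_attach.2 (Or.inr (ih h'))

theorem prefix_mem (h : IsRecursiveTree n t) {u w : Word} (hu : u ++ w ∈ t) : u ∈ t := by
  induction w using List.reverseRecOn with
  | nil => simpa using hu
  | append_singleton w j ih => exact ih (h.parent_mem (j := j) (by simpa using hu))

theorem stemmingSubtree_eq_empty (h : IsRecursiveTree n t) {u : Word} (hu : u ∉ t) :
    stemmingSubtree u t = ∅ := by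
  ext w
  simpa [mem_stemmingSubtree] using fun hw => hu (h.prefix_mem hw)

end IsRecursiveTree

/-! ### The mean of a functional of the uniform attachment tree -/

/-- One step of the uniform attachment chain, acting on functionals of trees. -/
noncomputable def stepMean (G : Finset Word → ℝ) (t : Finset Word) : ℝ :=
  (∑ v ∈ t, G (attach t v)) / t.card

/-- The mean of `G` under the law of the uniform attachment tree with `n + 1` nodes. -/
noncomputable def treeMean : ℕ → (Finset Word → ℝ) → ℝ
  | 0, G => G {[]}
  | n + 1, G => treeMean n (stepMean G)

theorem treeMean_mono {n : ℕ} {F G : Finset Word → ℝ}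
    (h : ∀ t, IsRecursiveTree n t → F t ≤ G t) : treeMean n F ≤ treeMean n G := by
  induction n generalizing F G with
  | zero => exact h _ .root
  | succ n ih =>
    refine ih fun t ht => ?_
    unfold stepMean
    gcongr with v hv
    exact h _ (ht.attach hv)

theorem treeMean_congr {n : ℕ} {F G : Finset Word → ℝ}
    (h : ∀ t, IsRecursiveTree n t → F t = G t) : treeMean n F = treeMean n G :=
  le_antisymm (treeMean_mono fun t ht => (h t ht).le) (treeMean_mono fun t ht => (h t ht).ge)

theorem treeMean_const_mul (n : ℕ) (c : ℝ) (G : Finset Word → ℝ) :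
    treeMean n (fun t => c * G t) = c * treeMean n G := by
  induction n generalizing G with
  | zero => rfl
  | succ n ih =>
    rw [treeMean, treeMean, ← ih]
    congr 1
    ext t
    rw [stepMean, stepMean, ← Finset.mul_sum, mul_div_assoc]

theorem treeMean_add (n : ℕ) (F G : Finset Word → ℝ) :
    treeMean n (fun t => F t + G t) = treeMean n F + treeMean n G := by
  induction n generalizing F G with
  | zero => rfl
  | succ n ih =>
    rw [treeMean, treeMean, treeMean, ← ih]
    congr 1
    ext t
    rw [stepMean, stepMean, stepMean, Finset.sum_add_distrib, add_div]

theorem treeMean_sum {ι : Type*} (n : ℕ) (s : Finset ι) (G : ι → Finset Word → ℝ) :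
    treeMean n (fun t => ∑ i ∈ s, G i t) = ∑ i ∈ s, treeMean n (G i) := by
  classical
  induction s using Finset.induction_on with
  | empty => simpa using treeMean_const_mul n 0 (fun _ => 0)
  | insert i s hi ih => simp only [Finset.sum_insert hi, treeMean_add, ih]

/-- Fubini for finite averages: steps in one tree commute with averaging over an independent one. -/
theorem stepMean_treeMean (n : ℕ) (F : Finset Word → Finset Word → ℝ) (s : Finset Word) :
    stepMean (fun a => treeMean n (F a)) s = treeMean n (fun b => stepMean (fun a => F a b) s) := by
  simp only [stepMean, div_eq_inv_mul, treeMean_const_mul, treeMean_sum]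

/-! ### Splitting a tree at the first child of its root -/

/-- Increase the first letter of a word by one. -/
def shift : Word → Word
  | [] => []
  | j :: w => (j + 1) :: w

theorem shift_injective : Function.Injective shift := by
  rintro (_ | ⟨i, v⟩) (_ | ⟨j, w⟩) h <;> simp_all [shift]

/-- The tree whose root has first subtree `a`, the rest of the tree being `b`. -/
def graft (a b : Finset Word) : Finset Word :=
  a.image (fun w => (1 : ℕ+) :: w) ∪ b.image shift

variable {a b : Finset Word}

theorem pnat_add_one_ne_one (j : ℕ+) : j + 1 ≠ 1 := (PNat.lt_add_left 1 j).ne'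

theorem pnat_cases (j : ℕ+) : j = 1 ∨ ∃ i : ℕ+, j = i + 1 := by
  by_cases h : j = 1
  · exact Or.inl h
  · exact Or.inr (PNat.exists_eq_succ_of_ne_one h)

theorem one_cons_mem_graft {w : Word} : (1 : ℕ+) :: w ∈ graft a b ↔ w ∈ a := by
  simp only [graft, Finset.mem_union, Finset.mem_image]
  constructor
  · rintro (⟨v, hv, h⟩ | ⟨v, _, h⟩)
    · cases h; exact hv
    · cases v with
      | nil => simp [shift] at h
      | cons j v => exact absurd (List.cons.inj h).1 (pnat_add_one_ne_one j)
  · exact fun h => Or.inl ⟨w, h, rfl⟩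

theorem shift_mem_graft {w : Word} : shift w ∈ graft a b ↔ w ∈ b := by
  simp only [graft, Finset.mem_union, Finset.mem_image]
  constructor
  · rintro (⟨v, _, h⟩ | ⟨v, hv, h⟩)
    · cases w with
      | nil => simp [shift] at h
      | cons j w => exact absurd (List.cons.inj h).1.symm (pnat_add_one_ne_one j)
    · rwa [← shift_injective h]
  · exact fun h => Or.inr ⟨w, h, rfl⟩

theorem succ_cons_mem_graft {j : ℕ+} {w : Word} : (j + 1) :: w ∈ graft a b ↔ j :: w ∈ b :=
  shift_mem_graft (w := j :: w)

theorem word_cases (w : Word) : (∃ v, w = (1 : ℕ+) :: v) ∨ ∃ v, w = shift v := by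
  rcases w with _ | ⟨j, w⟩
  · exact Or.inr ⟨[], rfl⟩
  · rcases pnat_cases j with rfl | ⟨i, rfl⟩
    · exact Or.inl ⟨w, rfl⟩
    · exact Or.inr ⟨i :: w, rfl⟩

theorem sum_graft (F : Word → ℝ) :
    ∑ w ∈ graft a b, F w = ∑ w ∈ a, F ((1 : ℕ+) :: w) + ∑ w ∈ b, F (shift w) := by
  rw [graft, Finset.sum_union, Finset.sum_image, Finset.sum_image]
  · exact shift_injective.injOn
  · exact List.cons_injective.injOn
  · rw [Finset.disjoint_left]
    intro w hw hw'
    obtain ⟨v, -, rfl⟩ := Finset.mem_image.1 hw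
    obtain ⟨u, -, h⟩ := Finset.mem_image.1 hw'
    rcases u with _ | ⟨j, u⟩
    · simp [shift] at h
    · exact pnat_add_one_ne_one j (List.cons.inj h).1

theorem card_graft : (graft a b).card = a.card + b.card := by
  have := sum_graft (a := a) (b := b) (fun _ => 1)
  simp only [Finset.sum_const, nsmul_eq_mul, mul_one] at this
  exact_mod_cast this

theorem childCount_one_cons_graft (w : Word) :
    childCount ((1 : ℕ+) :: w) (graft a b) = childCount w a := by
  unfold childCount
  congr 1
  ext j
  simp [one_cons_mem_graft]

theorem childCount_succ_cons_graft (i : ℕ+) (w : Word) :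
    childCount ((i + 1) :: w) (graft a b) = childCount (i :: w) b := by
  unfold childCount
  congr 1
  ext j
  simp [succ_cons_mem_graft]

theorem childCount_nil_graft (ha : [] ∈ a) :
    childCount [] (graft a b) = childCount [] b + 1 := by
  have : (graft a b).preimage (fun j : ℕ+ => [] ++ [j]) (child_injective []).injOn =
      insert 1 ((b.preimage (fun j : ℕ+ => [] ++ [j]) (child_injective []).injOn).image
        (fun j => j + 1)) := by
    ext j
    rcases pnat_cases j with rfl | ⟨i, rfl⟩
    · simpa [one_cons_mem_graft] using ha
    · simp [succ_cons_mem_graft, pnat_add_one_ne_one]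
  rw [childCount, this, Finset.card_insert_of_notMem,
    Finset.card_image_of_injective _ (add_left_injective 1), childCount]
  simp [pnat_add_one_ne_one]

theorem attach_graft_one_cons (v : Word) :
    attach (graft a b) ((1 : ℕ+) :: v) = graft (attach a v) b := by
  ext w
  rw [mem_attach, childCount_one_cons_graft]
  rcases word_cases w with ⟨w, rfl⟩ | ⟨w, rfl⟩
  · simp [one_cons_mem_graft, mem_attach]
  · rw [shift_mem_graft, shift_mem_graft, or_iff_right]
    rcases w with _ | ⟨j, w⟩
    · simp [shift]
    · simp [shift, pnat_add_one_ne_one]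

/-- The root of `b` becomes the root of the graft, where it has one more child because `[] ∈ a`. Its
next label is thus raised by one, exactly as `shift` does. -/
theorem attach_graft_shift (ha : [] ∈ a) (v : Word) :
    attach (graft a b) (shift v) = graft a (attach b v) := by
  have key : shift v ++ [Nat.succPNat (childCount (shift v) (graft a b))] =
      shift (v ++ [Nat.succPNat (childCount v b)]) := by
    rcases v with _ | ⟨i, v⟩
    · simp only [shift, List.nil_append, childCount_nil_graft ha, List.cons.injEq, and_true]
      rfl
    · simp only [shift, List.cons_append, childCount_succ_cons_graft]
  ext w
  rw [mem_attach, key]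
  rcases word_cases w with ⟨w, rfl⟩ | ⟨w, rfl⟩
  · rw [one_cons_mem_graft, one_cons_mem_graft, or_iff_right]
    intro h
    rcases v with _ | ⟨j, v⟩
    · exact pnat_add_one_ne_one _ (List.cons.inj h).1.symm
    · exact pnat_add_one_ne_one j (List.cons.inj h).1.symm
  · rw [shift_mem_graft, shift_mem_graft, mem_attach, shift_injective.eq_iff]

/-- A Pólya urn: the chosen node falls in `a` or `b` with probability proportional to size, and is
then uniform in that part. -/
theorem stepMean_graft {k l : ℕ} (ha : IsRecursiveTree k a) (hb : IsRecursiveTree l b)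
    (F : Finset Word → ℝ) :
    stepMean F (graft a b) =
      ((k + 1) * stepMean (fun s => F (graft s b)) a +
        (l + 1) * stepMean (fun s => F (graft a s)) b) / (k + l + 2) := by
  have hk : (k + 1 : ℝ) ≠ 0 := by positivity
  have hl : (l + 1 : ℝ) ≠ 0 := by positivity
  simp only [stepMean, sum_graft, attach_graft_one_cons, attach_graft_shift ha.nil_mem,
    card_graft, ha.card, hb.card]
  push_cast
  rw [mul_div_cancel₀ _ hk, mul_div_cancel₀ _ hl]
  ring

theorem treeMean_graft_stepMean (k l : ℕ) (F : Finset Word → ℝ) :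
    treeMean k (fun a => treeMean l fun b => stepMean F (graft a b)) =
      ((k + 1) * treeMean (k + 1) (fun a => treeMean l fun b => F (graft a b)) +
        (l + 1) * treeMean k (fun a => treeMean (l + 1) fun b => F (graft a b))) /
          (k + l + 2) := by
  have h1 : treeMean (k + 1) (fun a => treeMean l fun b => F (graft a b)) =
      treeMean k (fun a => treeMean l fun b => stepMean (fun s => F (graft s b)) a) := by
    rw [treeMean]
    congr 1
    ext a
    exact stepMean_treeMean l (fun a b => F (graft a b)) a
  rw [h1, ← treeMean_const_mul, ← treeMean_const_mul, ← treeMean_add, div_eq_inv_mul,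
    ← treeMean_const_mul]
  refine treeMean_congr fun a ha => ?_
  rw [treeMean, ← treeMean_const_mul, ← treeMean_const_mul, ← treeMean_add, ← treeMean_const_mul]
  refine treeMean_congr fun b hb => ?_
  rw [stepMean_graft ha hb, div_eq_inv_mul]

/-- The first subtree of the uniform attachment tree with `n + 2` nodes has uniform size, and
given its size it is a uniform attachment tree independent of the rest, which is another one. -/
theorem treeMean_succ_eq (n : ℕ) (F : Finset Word → ℝ) :
    treeMean (n + 1) F =
      (∑ k ∈ Finset.range (n + 1), treeMean k fun a => treeMean (n - k) fun b => F (graft a b)) /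
        (n + 1) := by
  induction n generalizing F with
  | zero =>
    have : attach {[]} [] = graft {[]} {[]} := by
      have h : childCount [] {[]} = 0 := by
        simp only [childCount, Finset.card_eq_zero]
        ext j
        simp
      ext w
      simp only [mem_attach, h, graft]
      simp [shift, Nat.succPNat, or_comm]
    simp [treeMean, stepMean, this]
  | succ n ih =>
    have hn : (n + 1 : ℝ) ≠ 0 := by positivity
    set D : ℕ → ℝ := fun k => treeMean k fun a => treeMean (n + 1 - k) fun b => F (graft a b)
      with hD
    have key : ∀ k ∈ Finset.range (n + 1),
        (treeMean k fun a => treeMean (n - k) fun b => stepMean F (graft a b)) =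
          (((k + 1 : ℕ) : ℝ) * D (k + 1) + (n + 1 - k) * D k) / (n + 2) := by
      intro k hk
      have hk' : k ≤ n := Nat.lt_succ_iff.1 (Finset.mem_range.1 hk)
      rw [treeMean_graft_stepMean, hD]
      simp only [show n + 1 - (k + 1) = n - k by omega, show n + 1 - k = n - k + 1 by omega]
      push_cast [Nat.cast_sub hk']
      ring
    -- The urn preserves uniformity: `D j` receives weight `j` from `k = j - 1` and `n + 1 - j` from
    -- `k = j`, in total `n + 1` for every `j`.
    have tot : ∑ k ∈ Finset.range (n + 1), (((k + 1 : ℕ) : ℝ) * D (k + 1) + (n + 1 - k) * D k) =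
        (n + 1) * ∑ k ∈ Finset.range (n + 2), D k := by
      have h1 := Finset.sum_range_succ' (fun k : ℕ => (k : ℝ) * D k) (n + 1)
      have h2 := Finset.sum_range_succ (fun k : ℕ => (n + 1 - k : ℝ) * D k) (n + 1)
      rw [Finset.sum_add_distrib, Finset.mul_sum]
      have h3 : ∑ k ∈ Finset.range (n + 2), (n + 1 : ℝ) * D k =
          ∑ k ∈ Finset.range (n + 1 + 1), (k : ℝ) * D k +
            ∑ k ∈ Finset.range (n + 1 + 1), (n + 1 - k : ℝ) * D k := by
        rw [← Finset.sum_add_distrib]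
        exact Finset.sum_congr rfl fun k _ => by ring
      rw [h3, h1, h2]
      push_cast
      ring
    rw [treeMean, ih, Finset.sum_congr rfl key, ← Finset.sum_div, tot]
    push_cast
    field_simp
    ring

/-! ### Path products -/

/-- The product of `g` over the nonempty prefixes of `u`. -/
def pathProd (g : Word → ℝ) (u : Word) : ℝ :=
  ∏ k ∈ Finset.range u.length, g (u.take (k + 1))

theorem pathProd_nil (g : Word → ℝ) : pathProd g [] = 1 := by simp [pathProd]

theorem pathProd_cons (g : Word → ℝ) (j : ℕ+) (w : Word) :
    pathProd g (j :: w) = g [j] * pathProd (fun v => g (j :: v)) w := by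
  simp [pathProd, Finset.prod_range_succ', mul_comm]

theorem pathProd_nonneg {g : Word → ℝ} (hg : ∀ v, 0 ≤ g v) (u : Word) : 0 ≤ pathProd g u :=
  Finset.prod_nonneg fun _ _ => hg _

theorem pathProd_congr {g g' : Word → ℝ} (h : ∀ v ≠ [], g v = g' v) (u : Word) :
    pathProd g u = pathProd g' u := by
  refine Finset.prod_congr rfl fun k hk => h _ ?_
  have := Finset.mem_range.1 hk
  rw [Ne, List.take_eq_nil_iff]
  rintro (h | rfl)
  · omega
  · simp at this

theorem pathProd_shift (g : Word → ℝ) (u : Word) :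
    pathProd g (shift u) = pathProd (fun v => g (shift v)) u := by
  cases u with
  | nil => simp [shift, pathProd_nil]
  | cons j w => simp [shift, pathProd_cons]

theorem pathProd_rpow {g : Word → ℝ} (hg : ∀ v, 0 ≤ g v) (β : ℝ) (u : Word) :
    pathProd (fun v => g v ^ β) u = pathProd g u ^ β :=
  Real.finsetProd_rpow _ _ (fun _ _ => hg _) _

theorem pathProd_eq_zero {g : Word → ℝ} {u : Word} (hu : u ≠ []) (h : g u = 0) :
    pathProd g u = 0 := by
  have hl : 0 < u.length := List.length_pos_iff.2 hu
  refine Finset.prod_eq_zero (i := u.length - 1) (Finset.mem_range.2 (by omega)) ?_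
  rwa [Nat.sub_add_cancel hl, List.take_length]

theorem proportion_nonneg (N : ℕ) (t : Finset Word) (u : Word) : 0 ≤ proportion N t u := by
  unfold proportion; positivity

theorem proportion_graft_one_cons (N : ℕ) (a b : Finset Word) (w : Word) :
    proportion N (graft a b) ((1 : ℕ+) :: w) = proportion N a w := by
  have : stemmingSubtree ((1 : ℕ+) :: w) (graft a b) = stemmingSubtree w a := by
    ext v
    simp [mem_stemmingSubtree, one_cons_mem_graft]
  rw [proportion, this, proportion]

theorem proportion_graft_shift (N : ℕ) (a b : Finset Word) {w : Word} (hw : w ≠ []) :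
    proportion N (graft a b) (shift w) = proportion N b w := by
  have : stemmingSubtree (shift w) (graft a b) = stemmingSubtree w b := by
    cases w with
    | nil => exact absurd rfl hw
    | cons j w =>
      ext v
      simp [mem_stemmingSubtree, shift, succ_cons_mem_graft]
  rw [proportion, this, proportion]

theorem proportion_nil (N : ℕ) (t : Finset Word) : proportion N t [] = (t.card : ℝ) / N := by
  have : stemmingSubtree [] t = t := by
    ext v
    simp [mem_stemmingSubtree]
  rw [proportion, this]

/-- The sum over the nodes of `t` of the `β`-th powers of the path products of the proportions,
relative to a total mass `N`. -/
noncomputable def powerSum (β : ℝ) (N : ℕ) (t : Finset Word) : ℝ :=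
  ∑ u ∈ t, pathProd (fun v => proportion N t v ^ β) u

/-- Since `N` need not be the size of the tree, no proportion is renormalised in the two parts.
Paths through the first child only gain that child's factor. -/
theorem powerSum_graft (β : ℝ) (N : ℕ) (a b : Finset Word) :
    powerSum β N (graft a b) = ((a.card : ℝ) / N) ^ β * powerSum β N a + powerSum β N b := by
  unfold powerSum
  rw [sum_graft, Finset.mul_sum]
  congr 1
  · refine Finset.sum_congr rfl fun w _ => ?_
    rw [pathProd_cons]
    simp only [proportion_graft_one_cons, proportion_nil]
  · refine Finset.sum_congr rfl fun w _ => ?_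
    rw [pathProd_shift]
    exact pathProd_congr (fun v hv => by rw [proportion_graft_shift N a b hv]) w

/-! ### Exponential moments -/

/-- A supersolution of the recursion for the mean of `powerSum β N` on trees with `m + 1` nodes. -/
noncomputable def growth (β : ℝ) (N m : ℕ) : ℝ :=
  ∏ k ∈ Finset.range m, (1 + 2 * (((k + 1 : ℕ) : ℝ) / N) ^ β / (k + 1 : ℕ))

section growth

variable {β : ℝ} {N m : ℕ}

theorem growth_zero : growth β N 0 = 1 := by simp [growth]

theorem growth_pos (β : ℝ) (N m : ℕ) : 0 < growth β N m :=
  Finset.prod_pos fun _ _ => by positivity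

theorem growth_succ (β : ℝ) (N m : ℕ) : growth β N (m + 1) =
    growth β N m + 2 * (((m + 1 : ℕ) : ℝ) / N) ^ β * growth β N m / (m + 1 : ℕ) := by
  rw [growth, Finset.prod_range_succ, ← growth]
  ring

theorem growth_mono (β : ℝ) (N : ℕ) : Monotone (growth β N) :=
  monotone_nat_of_le_succ fun m => by
    rw [growth_succ]
    have := growth_pos β N m
    exact le_add_of_nonneg_right (by positivity)

/-- Discrete form of `∫₀^m t ^ (β - 1) dt = m ^ β / β`. Each increment is controlled by Bernoulli's
inequality for exponents in `[0, 1]`. -/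
theorem sum_rpow_div_le (hβ : 0 < β) (hβ1 : β ≤ 1) (m : ℕ) :
    ∑ k ∈ Finset.range m, ((k + 1 : ℕ) : ℝ) ^ β / (k + 1 : ℕ) ≤ (m : ℝ) ^ β / β := by
  induction m with
  | zero => simp [hβ.ne']
  | succ m ih =>
    rw [Finset.sum_range_succ]
    refine (add_le_add_left ih _).trans ?_
    have hm : (0 : ℝ) < (m + 1 : ℕ) := by positivity
    have h1 := rpow_one_add_le_one_add_mul_self (s := -(1 / ((m + 1 : ℕ) : ℝ)))
      (by rw [neg_le_neg_iff, div_le_one hm]; simp) hβ.le hβ1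
    have h2 : (m : ℝ) = (m + 1 : ℕ) * (1 + -(1 / ((m + 1 : ℕ) : ℝ))) := by
      field_simp
      push_cast
      ring
    have h3 : (0 : ℝ) ≤ 1 + -(1 / ((m + 1 : ℕ) : ℝ)) := by
      rw [← sub_eq_add_neg, sub_nonneg, div_le_one hm]; simp
    have h4 : (m : ℝ) ^ β ≤ ((m + 1 : ℕ) : ℝ) ^ β * (1 + β * -(1 / ((m + 1 : ℕ) : ℝ))) := by
      rw [h2, Real.mul_rpow hm.le h3]
      gcongr
    rw [div_add' _ _ _ hβ.ne', div_le_div_iff_of_pos_right hβ]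
    calc (m : ℝ) ^ β + ((m + 1 : ℕ) : ℝ) ^ β / (m + 1 : ℕ) * β
        ≤ ((m + 1 : ℕ) : ℝ) ^ β * (1 + β * -(1 / ((m + 1 : ℕ) : ℝ))) +
          ((m + 1 : ℕ) : ℝ) ^ β / (m + 1 : ℕ) * β := by gcongr
      _ = ((m + 1 : ℕ) : ℝ) ^ β := by ring

theorem growth_le (hβ : 0 < β) (hβ1 : β ≤ 1) (hm : m ≤ N) :
    growth β N m ≤ Real.exp (2 / β) := by
  have h1 : growth β N m ≤ ∏ k ∈ Finset.range m,
      Real.exp (2 * (((k + 1 : ℕ) : ℝ) / N) ^ β / (k + 1 : ℕ)) := by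
    refine Finset.prod_le_prod (fun _ _ => by positivity) fun k _ => ?_
    rw [add_comm]
    exact Real.add_one_le_exp _
  refine h1.trans ?_
  rw [← Real.exp_sum, Real.exp_le_exp]
  have h2 : ∑ k ∈ Finset.range m, 2 * (((k + 1 : ℕ) : ℝ) / N) ^ β / (k + 1 : ℕ) =
      2 / (N : ℝ) ^ β * ∑ k ∈ Finset.range m, ((k + 1 : ℕ) : ℝ) ^ β / (k + 1 : ℕ) := by
    rw [Finset.mul_sum]
    refine Finset.sum_congr rfl fun k _ => ?_
    rw [Real.div_rpow (by positivity) (by positivity)]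
    ring
  rw [h2]
  calc 2 / (N : ℝ) ^ β * ∑ k ∈ Finset.range m, ((k + 1 : ℕ) : ℝ) ^ β / (k + 1 : ℕ)
      ≤ 2 / (N : ℝ) ^ β * ((N : ℝ) ^ β / β) := by
        gcongr
        refine (sum_rpow_div_le hβ hβ1 m).trans ?_
        gcongr
    _ = (N : ℝ) ^ β / (N : ℝ) ^ β * (2 / β) := by ring
    -- For `N = 0` the quotient is `0 / 0 = 0`, so only an inequality is available.
    _ ≤ 1 * (2 / β) := by gcongr; exact div_self_le_one _
    _ = 2 / β := one_mul _

/-- The exact recursion for the mean would have coefficient 1 on the right. The factor 2 in `growth`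
leaves room for the quadratic term of the exponential. -/
theorem sum_growth_sub (β : ℝ) (N m : ℕ) :
    ∑ k ∈ Finset.range m, (growth β N m - growth β N k) =
      2 * ∑ k ∈ Finset.range m, (((k + 1 : ℕ) : ℝ) / N) ^ β * growth β N k := by
  induction m with
  | zero => simp
  | succ m ih =>
    have h : ∑ k ∈ Finset.range m, (growth β N (m + 1) - growth β N k) =
        ∑ k ∈ Finset.range m, (growth β N m - growth β N k) +
          m * (growth β N (m + 1) - growth β N m) := by
      simp only [Finset.sum_sub_distrib, Finset.sum_const, Finset.card_range, nsmul_eq_mul]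
      ring
    rw [Finset.sum_range_succ, h, ih, Finset.sum_range_succ, growth_succ]
    field_simp
    push_cast
    ring

theorem exp_le_one_add_add_sq {x : ℝ} (h : |x| ≤ 1) : Real.exp x ≤ 1 + x + x ^ 2 := by
  have := (abs_le.1 (Real.abs_exp_sub_one_sub_id_le h)).2
  linarith

theorem sum_exp_growth_le (hβ : 0 < β) (hβ1 : β ≤ 1) (hm : m + 1 ≤ N) {l : ℝ} (hl : 0 ≤ l)
    (hlH : l * Real.exp (2 / β) ≤ 1 / 3) :
    (∑ k ∈ Finset.range (m + 1), Real.exp (l * (((k + 1 : ℕ) : ℝ) / N) ^ β * growth β N k +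
      l * growth β N (m - k))) / (m + 1) ≤ Real.exp (l * growth β N (m + 1)) := by
  set H := Real.exp (2 / β)
  set a : ℕ → ℝ := fun k => (((k + 1 : ℕ) : ℝ) / N) ^ β * growth β N k with ha
  set b : ℕ → ℝ := fun k => growth β N (m + 1) - growth β N (m - k) with hb
  -- `sum_growth_sub` after the reflection `k ↦ m - k`.
  have hsum : ∑ k ∈ Finset.range (m + 1), b k = 2 * ∑ k ∈ Finset.range (m + 1), a k := by
    rw [← sum_growth_sub, ← Finset.sum_range_reflect]
    refine Finset.sum_congr rfl fun k hk => ?_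
    rw [hb]
    simp only [show m + 1 - 1 - k = m - k by omega,
      show m - (m - k) = k by have := Finset.mem_range.1 hk; omega]
  have ha0 : ∀ k, 0 ≤ a k := fun k => by have := growth_pos β N k; positivity
  have haH : ∀ k ∈ Finset.range (m + 1), a k ≤ H := by
    intro k hk
    have hkN : k + 1 ≤ N := by have := Finset.mem_range.1 hk; omega
    have h1 : (((k + 1 : ℕ) : ℝ) / N) ^ β ≤ 1 :=
      Real.rpow_le_one (by positivity) (div_le_one_of_le₀ (by exact_mod_cast hkN) (by positivity))
        hβ.le
    calc a k ≤ 1 * growth β N k := by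
          rw [ha]; exact mul_le_mul_of_nonneg_right h1 (growth_pos β N k).le
      _ ≤ H := by rw [one_mul]; exact growth_le hβ hβ1 (by omega)
  have hb0 : ∀ k, 0 ≤ b k := fun k => sub_nonneg.2 (growth_mono β N (by omega))
  have hbH : ∀ k, b k ≤ H := fun k =>
    (sub_le_self _ (growth_pos β N _).le).trans (growth_le hβ hβ1 hm)
  have hterm : ∀ k ∈ Finset.range (m + 1),
      Real.exp (l * (a k - b k)) ≤ 1 + l * (a k - b k) + l / 3 * (a k + b k) := by
    intro k hk
    have h1 : |l * (a k - b k)| ≤ 1 := by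
      rw [abs_mul, abs_of_nonneg hl]
      have : |a k - b k| ≤ H :=
        abs_le.2 ⟨by linarith [ha0 k, hbH k], by linarith [hb0 k, haH k hk]⟩
      nlinarith
    refine (exp_le_one_add_add_sq h1).trans ?_
    -- Both terms lie in `[0, H]`, so the square is at most `H` times their sum; with `l * H ≤ 1 /
    -- 3` the quadratic term becomes linear.
    have h2 : (a k - b k) ^ 2 ≤ H * (a k + b k) := by
      nlinarith [ha0 k, hb0 k, haH k hk, hbH k, mul_nonneg (ha0 k) (hb0 k)]
    have h3 : (l * (a k - b k)) ^ 2 ≤ l / 3 * (a k + b k) := by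
      calc (l * (a k - b k)) ^ 2 = l * (l * (a k - b k) ^ 2) := by ring
        _ ≤ l * (l * (H * (a k + b k))) := by gcongr
        _ = l * ((l * H) * (a k + b k)) := by ring
        _ ≤ l * (1 / 3 * (a k + b k)) := by
          have := add_nonneg (ha0 k) (hb0 k)
          gcongr
        _ = _ := by ring
    linarith
  have htot : ∑ k ∈ Finset.range (m + 1), Real.exp (l * (a k - b k)) ≤ m + 1 := by
    -- With `A = ∑ a k` and `∑ b k = 2 * A`, the corrections cancel exactly: `l * (A - 2 * A) + l /
    -- 3 * (A + 2 * A) = 0`. This is why the threshold is 1/3.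
    refine (Finset.sum_le_sum hterm).trans (le_of_eq ?_)
    simp only [Finset.sum_add_distrib, ← Finset.mul_sum, Finset.sum_sub_distrib, hsum]
    simp
    ring
  rw [div_le_iff₀ (by positivity)]
  calc _ = ∑ k ∈ Finset.range (m + 1),
        Real.exp (l * growth β N (m + 1)) * Real.exp (l * (a k - b k)) := by
        refine Finset.sum_congr rfl fun k _ => ?_
        rw [← Real.exp_add, ha, hb]
        congr 1
        ring
    _ ≤ _ := by
        rw [← Finset.mul_sum]
        gcongr

theorem treeMean_exp_powerSum_le (hβ : 0 < β) (hβ1 : β ≤ 1) (hm : m + 1 ≤ N) {l : ℝ}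
    (hl : 0 ≤ l) (hlH : l * Real.exp (2 / β) ≤ 1 / 3) :
    treeMean m (fun t => Real.exp (l * powerSum β N t)) ≤ Real.exp (l * growth β N m) := by
  -- `l` must vary: the first subtree is used with the smaller parameter `l * p`.
  induction m using Nat.strong_induction_on generalizing l with
  | _ m ih =>
  rcases m with _ | m
  · simp [treeMean, powerSum, pathProd_nil, growth_zero]
  · rw [treeMean_succ_eq]
    refine le_trans ?_ (sum_exp_growth_le hβ hβ1 (by omega : m + 1 ≤ N) hl hlH)
    gcongr with k hk
    have hk' : k ≤ m := Nat.lt_succ_iff.1 (Finset.mem_range.1 hk)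
    set p : ℝ := (((k + 1 : ℕ) : ℝ) / N) ^ β with hp
    have hp0 : 0 ≤ p := by positivity
    have hp1 : p ≤ 1 := Real.rpow_le_one (by positivity)
      (div_le_one_of_le₀ (by exact_mod_cast (by omega : k + 1 ≤ N)) (by positivity)) hβ.le
    have hprod : (treeMean k fun a => treeMean (m - k) fun b =>
        Real.exp (l * powerSum β N (graft a b))) =
        treeMean (m - k) (fun b => Real.exp (l * powerSum β N b)) *
          treeMean k (fun a => Real.exp (l * p * powerSum β N a)) := by
      rw [← treeMean_const_mul]
      refine treeMean_congr fun a ha => ?_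
      rw [mul_comm, ← treeMean_const_mul]
      refine treeMean_congr fun b _ => ?_
      rw [powerSum_graft, ha.card, ← Real.exp_add, ← hp]
      congr 1
      ring
    have hlp : l * p ≤ l := mul_le_of_le_one_right hl hp1
    have h1 := ih k (by omega) (by omega) (mul_nonneg hl hp0)
      ((mul_le_mul_of_nonneg_right hlp (Real.exp_pos _).le).trans hlH)
    have h2 := ih (m - k) (by omega) (by omega) hl hlH
    rw [hprod, add_comm, Real.exp_add]
    have h0 : 0 ≤ treeMean k (fun a => Real.exp (l * p * powerSum β N a)) := by
      -- Zero is written `0 * 0` so that `treeMean_const_mul` evaluates its mean.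
      have := treeMean_mono (n := k) (F := fun _ => 0 * 0)
        (G := fun a => Real.exp (l * p * powerSum β N a))
        fun a _ => by rw [mul_zero]; exact (Real.exp_pos _).le
      rwa [treeMean_const_mul, zero_mul] at this
    gcongr

theorem treeMean_exp_powerSum_le_two (hβ : 0 < β) (hβ1 : β ≤ 1) (m : ℕ) :
    treeMean m (fun t => Real.exp (Real.exp (-(2 / β)) / 3 * powerSum β (m + 1) t)) ≤ 2 := by
  have h : Real.exp (-(2 / β)) / 3 * Real.exp (2 / β) = 1 / 3 := by
    rw [div_mul_eq_mul_div, ← Real.exp_add]; simp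
  refine (treeMean_exp_powerSum_le hβ hβ1 le_rfl (by positivity) h.le).trans ?_
  have h1 : Real.exp (-(2 / β)) / 3 * growth β (m + 1) m ≤ 1 / 3 := by
    rw [← h]
    gcongr
    exact growth_le hβ hβ1 (by omega)
  have h2 := exp_le_one_add_add_sq (x := (1 / 3 : ℝ)) (by rw [abs_of_pos] <;> norm_num)
  exact (Real.exp_le_exp.2 h1).trans (h2.trans (by norm_num))

end growth

/-! ### The law of the process -/

instance : MeasurableSpace Word := ⊤

instance : DiscreteMeasurableSpace Word := ⟨fun _ => trivial⟩

instance : MeasurableSpace (Finset Word) := ⊤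

instance : DiscreteMeasurableSpace (Finset Word) := ⟨fun _ => trivial⟩

/-- The trees `T_1, …, T_n`. -/
def history {Ω : Type*} (T : ℕ → Ω → Finset Word) (n : ℕ) (ω : Ω) : Fin n → Finset Word :=
  fun i => T (i + 1) ω

theorem stepMean_nonneg {G : Finset Word → ℝ} (hG : ∀ t, 0 ≤ G t) (t : Finset Word) :
    0 ≤ stepMean G t :=
  div_nonneg (Finset.sum_nonneg fun _ _ => hG _) (Nat.cast_nonneg _)

/-- The mean proportion of a subtree does not decrease in one step. -/
theorem proportion_le_stepMean {n : ℕ} {t : Finset Word} (ht : IsRecursiveTree n t) (u : Word) :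
    proportion (n + 1) t u ≤ stepMean (fun s => proportion (n + 2) s u) t := by
  -- The inequality can be strict: the new node may be `u` itself, whose parent does not have `u` as
  -- a prefix. Hence a submartingale and not a martingale.
  have hterm : ∀ v ∈ t, ((stemmingSubtree u t).card : ℝ) + (if u <+: v then 1 else 0) ≤
      (stemmingSubtree u (attach t v)).card := by
    intro v _
    have hsub : stemmingSubtree u t ⊆ stemmingSubtree u (attach t v) := fun w hw =>
      mem_stemmingSubtree.2 (mem_attach.2 (Or.inr (mem_stemmingSubtree.1 hw)))
    split_ifs with huv
    · obtain ⟨w, rfl⟩ := huv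
      have : w ++ [Nat.succPNat (childCount (u ++ w) t)] ∉ stemmingSubtree u t := by
        rw [mem_stemmingSubtree, ← List.append_assoc]
        exact ht.newChild_not_mem _
      have hlt : (stemmingSubtree u t).card < (stemmingSubtree u (attach t (u ++ w))).card := by
        refine Finset.card_lt_card ((Finset.ssubset_iff_of_subset hsub).2 ⟨_, ?_, this⟩)
        rw [mem_stemmingSubtree, mem_attach, List.append_assoc]
        exact Or.inl rfl
      exact_mod_cast hlt
    · rw [add_zero]
      exact_mod_cast Finset.card_le_card hsub
  have hcount : (∑ v ∈ t, if u <+: v then (1 : ℝ) else 0) = (stemmingSubtree u t).card := by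
    rw [← Finset.sum_filter, Finset.sum_const, nsmul_eq_mul, mul_one]
    congr 1
    have : t.filter (fun v => u <+: v) = (stemmingSubtree u t).image (fun w => u ++ w) := by
      ext v
      simp only [Finset.mem_filter, Finset.mem_image, mem_stemmingSubtree]
      constructor
      · rintro ⟨hv, w, rfl⟩
        exact ⟨w, hv, rfl⟩
      · rintro ⟨w, hw, rfl⟩
        exact ⟨hw, w, rfl⟩
    rw [this, Finset.card_image_of_injective _ (List.append_right_injective u)]
  -- With `s` the subtree size, the mean size after one step is at least `s + s / (n + 1)`; dividing
  -- by `n + 2` gives `s / (n + 1)`.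
  have hsum := Finset.sum_le_sum hterm
  rw [Finset.sum_add_distrib, hcount, Finset.sum_const, ht.card, nsmul_eq_mul] at hsum
  push_cast at hsum
  unfold stepMean proportion
  rw [← Finset.sum_div, ht.card, div_div, div_le_div_iff₀ (by positivity) (by positivity)]
  push_cast
  nlinarith

theorem proportion_le_one {n : ℕ} {t : Finset Word} (ht : IsRecursiveTree n t) (u : Word) :
    proportion (n + 1) t u ≤ 1 := by
  refine div_le_one_of_le₀ ?_ (by positivity)
  rw [← ht.card, Nat.cast_le]
  refine Finset.card_le_card_of_injOn (fun w => u ++ w) (fun w hw => ?_)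
    (List.append_right_injective u).injOn
  exact mem_stemmingSubtree.1 hw

namespace IsUniformAttachment

variable {Ω : Type*} [MeasurableSpace Ω] {μ : Measure Ω} {T : ℕ → Ω → Finset Word}
  {V : ℕ → Ω → Word}

theorem measurable_node (h : IsUniformAttachment μ T V) {n : ℕ} (hn : 1 ≤ n) :
    Measurable (V n) :=
  measurable_to_countable' fun v => h.measurableSet_eq n hn v

theorem measurable_tree (h : IsUniformAttachment μ T V) (n : ℕ) : Measurable (T (n + 1)) := by
  induction n with
  | zero =>
    rw [show T (0 + 1) = fun _ => {[]} from funext h.init]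
    exact measurable_const
  | succ n ih =>
    rw [show T (n + 1 + 1) = (fun p : Finset Word × Word => attach p.1 p.2) ∘
      fun ω => (T (n + 1) ω, V (n + 1) ω) from funext (h.step (n + 1) (by omega))]
    exact Measurable.of_discrete.comp (ih.prodMk (h.measurable_node (by omega)))

theorem measurable_history (h : IsUniformAttachment μ T V) (n : ℕ) : Measurable (history T n) :=
  measurable_pi_lambda _ fun i => h.measurable_tree i

theorem nil_mem (h : IsUniformAttachment μ T V) (n : ℕ) (ω : Ω) : [] ∈ T (n + 1) ω := by
  induction n with
  | zero => simp [h.init]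
  | succ n ih =>
    rw [h.step (n + 1) (by omega)]
    exact mem_attach.2 (Or.inr ih)

theorem measure_history_inter (h : IsUniformAttachment μ T V) {n : ℕ}
    (t : Fin (n + 1) → Finset Word) {v : Word} (hv : v ∈ t (Fin.last n)) :
    μ (history T (n + 1) ⁻¹' {t} ∩ V (n + 1) ⁻¹' {v}) =
      μ (history T (n + 1) ⁻¹' {t}) / ((t (Fin.last n)).card : ℝ≥0∞) := by
  -- Tree indices start at 1 and `Fin` at 0; values of `t'` outside `1, …, n + 1` play no role.
  set t' : ℕ → Finset Word := fun i => if hi : i - 1 < n + 1 then t ⟨i - 1, hi⟩ else ∅ with ht'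
  have hlast : t' (n + 1) = t (Fin.last n) := by simp [ht', Fin.last]
  have hset : history T (n + 1) ⁻¹' {t} = {ω | ∀ i ∈ Finset.Icc 1 (n + 1), T i ω = t' i} := by
    ext ω
    simp only [Set.mem_preimage, Set.mem_singleton_iff, Set.mem_ofPred_eq, funext_iff, history,
      Finset.mem_Icc]
    constructor
    · rintro hω i ⟨hi1, hi2⟩
      have := hω ⟨i - 1, by omega⟩
      simp only [ht', show i - 1 < n + 1 by omega, dif_pos, ← this]
      rw [Nat.sub_add_cancel hi1]
    · intro hω i
      rw [hω (i + 1) ⟨by omega, by omega⟩]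
      simp only [ht', Nat.add_sub_cancel, i.is_lt, dif_pos]
  have := h.uniform (n + 1) (by omega) t' v (by rwa [hlast])
  rw [hlast, ← hset] at this
  rw [← this]
  congr 1
  ext ω
  simp [hset]

/-- The `|t|` pieces each carry a fraction `1 / |t|` of the mass, hence exhaust it. That `V_n ∈ T_n`
almost surely is therefore a consequence of uniformity. -/
theorem measure_history_eq (h : IsUniformAttachment μ T V) [IsFiniteMeasure μ] {n : ℕ}
    (t : Fin (n + 1) → Finset Word) :
    (⋃ v ∈ t (Fin.last n), history T (n + 1) ⁻¹' {t} ∩ V (n + 1) ⁻¹' {v} : Set Ω) =ᵐ[μ]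
      (history T (n + 1) ⁻¹' {t} : Set Ω) := by
  have hm : MeasurableSet (history T (n + 1) ⁻¹' {t}) :=
    h.measurable_history _ (MeasurableSet.of_discrete)
  have hm' : ∀ v ∈ t (Fin.last n),
      MeasurableSet (history T (n + 1) ⁻¹' {t} ∩ V (n + 1) ⁻¹' {v}) := fun v _ =>
    hm.inter (h.measurable_node (by omega) (MeasurableSet.of_discrete))
  refine ae_eq_of_subset_of_measure_ge (Set.iUnion₂_subset fun v _ => Set.inter_subset_left) ?_
    (Finset.measurableSet_biUnion _ hm').nullMeasurableSet (measure_ne_top _ _)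
  by_cases ht : (t (Fin.last n)).card = 0
  · have : history T (n + 1) ⁻¹' {t} = ∅ := by
      ext ω
      simp only [Set.mem_preimage, Set.mem_singleton_iff, Set.mem_empty_iff_false, iff_false]
      rintro rfl
      have := h.nil_mem n ω
      simp only [history, Fin.val_last, Finset.card_eq_zero] at ht
      simp [ht] at this
    simp [this]
  · rw [measure_biUnion_finset _ hm', Finset.sum_congr rfl fun v hv => h.measure_history_inter t hv,
      Finset.sum_const, nsmul_eq_mul, ENNReal.mul_div_cancel (by exact_mod_cast ht) (by simp)]
    intro v _ w _ hvw
    refine Set.disjoint_left.2 fun ω h1 h2 => hvw ?_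
    rw [← h1.2, ← h2.2]

theorem ae_node_mem (h : IsUniformAttachment μ T V) [IsFiniteMeasure μ] (n : ℕ) :
    ∀ᵐ ω ∂μ, V (n + 1) ω ∈ T (n + 1) ω := by
  filter_upwards [ae_all_iff.2 fun t => (h.measure_history_eq (n := n) t).mem_iff] with ω hω
  have := (hω (history T (n + 1) ω)).2 rfl
  simp only [Set.mem_iUnion] at this
  obtain ⟨v, hv, -, rfl⟩ := this
  exact hv

theorem ae_isRecursiveTree (h : IsUniformAttachment μ T V) [IsFiniteMeasure μ] :
    ∀ᵐ ω ∂μ, ∀ n, IsRecursiveTree n (T (n + 1) ω) := by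
  filter_upwards [ae_all_iff.2 h.ae_node_mem] with ω hω n
  induction n with
  | zero => simpa [h.init] using IsRecursiveTree.root
  | succ n ih =>
    rw [h.step (n + 1) (by omega)]
    exact ih.attach (hω n)

/-- The Markov property, integrated over an event of the past. There are countably many histories,
so it suffices to check it on each one. -/
theorem setLIntegral_step (h : IsUniformAttachment μ T V) [IsFiniteMeasure μ] {n : ℕ}
    {G : Finset Word → ℝ} (hG : ∀ t, 0 ≤ G t) (S : Set (Fin (n + 1) → Finset Word)) :
    ∫⁻ ω in history T (n + 1) ⁻¹' S, ENNReal.ofReal (G (T (n + 2) ω)) ∂μ =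
      ∫⁻ ω in history T (n + 1) ⁻¹' S, ENNReal.ofReal (stepMean G (T (n + 1) ω)) ∂μ := by
  have hm : ∀ t, MeasurableSet (history T (n + 1) ⁻¹' {t}) := fun t =>
    h.measurable_history _ (MeasurableSet.of_discrete)
  have hS : history T (n + 1) ⁻¹' S = ⋃ t ∈ S, history T (n + 1) ⁻¹' {t} := by
    ext ω; simp
  have hd : S.PairwiseDisjoint fun t => history T (n + 1) ⁻¹' {t} := by
    intro s _ t _ hst
    refine Set.disjoint_left.2 fun ω h1 h2 => hst ?_
    rw [← Set.mem_singleton_iff.1 h1, ← Set.mem_singleton_iff.1 h2]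
  rw [hS, lintegral_biUnion S.to_countable (fun t _ => hm t) hd,
    lintegral_biUnion S.to_countable (fun t _ => hm t) hd]
  refine tsum_congr fun ⟨t, _⟩ => ?_
  have hlast : ∀ ω ∈ history T (n + 1) ⁻¹' {t}, T (n + 1) ω = t (Fin.last n) := by
    rintro ω rfl
    rfl
  have hR : ∫⁻ ω in history T (n + 1) ⁻¹' {t}, ENNReal.ofReal (stepMean G (T (n + 1) ω)) ∂μ =
      ENNReal.ofReal (stepMean G (t (Fin.last n))) * μ (history T (n + 1) ⁻¹' {t}) := by
    rw [← setLIntegral_const]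
    exact setLIntegral_congr_fun (hm t) fun ω hω => by rw [hlast ω hω]
  rw [hR, ← setLIntegral_congr (h.measure_history_eq t), lintegral_biUnion_finset]
  · have hv : ∀ v ∈ t (Fin.last n),
        ∫⁻ ω in history T (n + 1) ⁻¹' {t} ∩ V (n + 1) ⁻¹' {v}, ENNReal.ofReal (G (T (n + 2) ω)) ∂μ =
        ENNReal.ofReal (G (attach (t (Fin.last n)) v)) *
          (μ (history T (n + 1) ⁻¹' {t}) / ((t (Fin.last n)).card : ℝ≥0∞)) := by
      intro v hv
      rw [← h.measure_history_inter t hv, ← setLIntegral_const]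
      refine setLIntegral_congr_fun
        ((hm t).inter (h.measurable_node (by omega) (MeasurableSet.of_discrete))) ?_
      rintro ω ⟨hω, rfl⟩
      simp only
      rw [h.step (n + 1) (by omega), hlast ω hω]
    rw [Finset.sum_congr rfl hv, ← Finset.sum_mul, ← ENNReal.ofReal_sum_of_nonneg fun _ _ => hG _]
    by_cases ht : (t (Fin.last n)).card = 0
    · simp [Finset.card_eq_zero.1 ht, stepMean]
    · rw [stepMean, ENNReal.ofReal_div_of_pos (by exact_mod_cast Nat.pos_of_ne_zero ht),
        ENNReal.ofReal_natCast]
      simp only [div_eq_mul_inv]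
      ring
  · intro v _ w _ hvw
    refine Set.disjoint_left.2 fun ω h1 h2 => hvw ?_
    rw [← h1.2, ← h2.2]
  · exact fun v _ => (hm t).inter (h.measurable_node (by omega) (MeasurableSet.of_discrete))

theorem lintegral_eq_treeMean (h : IsUniformAttachment μ T V) [IsProbabilityMeasure μ] {n : ℕ}
    {G : Finset Word → ℝ} (hG : ∀ t, 0 ≤ G t) :
    ∫⁻ ω, ENNReal.ofReal (G (T (n + 1) ω)) ∂μ = ENNReal.ofReal (treeMean n G) := by
  induction n generalizing G with
  | zero => simp [h.init, treeMean]
  | succ n ih =>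
    rw [treeMean, ← ih (stepMean_nonneg hG)]
    simpa using h.setLIntegral_step (n := n) hG Set.univ

/-! ### Convergence of the proportions -/

/-- The filtration generated by the trees. -/
def filtration (h : IsUniformAttachment μ T V) : Filtration ℕ ‹MeasurableSpace Ω› where
  seq n := MeasurableSpace.comap (history T (n + 1)) inferInstance
  mono' := by
    intro m n hmn
    have : history T (m + 1) =
        (fun s : Fin (n + 1) → Finset Word => fun i => s (Fin.castLE (by omega) i)) ∘
          history T (n + 1) := rfl
    simp only
    rw [this, ← MeasurableSpace.comap_comp]
    exact MeasurableSpace.comap_mono Measurable.of_discrete.comap_le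
  le' n := (h.measurable_history (n + 1)).comap_le

theorem stronglyMeasurable_tree (h : IsUniformAttachment μ T V) (n : ℕ) (G : Finset Word → ℝ) :
    StronglyMeasurable[h.filtration n] fun ω => G (T (n + 1) ω) := by
  have : (fun ω => G (T (n + 1) ω)) =
      (fun s : Fin (n + 1) → Finset Word => G (s (Fin.last n))) ∘ history T (n + 1) := rfl
  rw [this]
  exact (Measurable.of_discrete.comp (comap_measurable _)).stronglyMeasurable

variable [IsProbabilityMeasure μ]

theorem ae_norm_proportion_le (h : IsUniformAttachment μ T V) (u : Word) (n : ℕ) :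
    ∀ᵐ ω ∂μ, ‖proportion (n + 1) (T (n + 1) ω) u‖ ≤ 1 := by
  filter_upwards [h.ae_isRecursiveTree] with ω hω
  rw [Real.norm_of_nonneg (proportion_nonneg _ _ _)]
  exact proportion_le_one (hω n) u

theorem integrable_proportion (h : IsUniformAttachment μ T V) (u : Word) (n : ℕ) :
    Integrable (fun ω => proportion (n + 1) (T (n + 1) ω) u) μ :=
  .of_bound ((h.stronglyMeasurable_tree n fun t => proportion (n + 1) t u).mono
    (h.filtration.le n)).aestronglyMeasurable 1 (h.ae_norm_proportion_le u n)

theorem submartingale_proportion (h : IsUniformAttachment μ T V) (u : Word) :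
    Submartingale (fun n ω => proportion (n + 1) (T (n + 1) ω) u) h.filtration μ := by
  refine submartingale_of_setIntegral_le_succ
    (fun n => h.stronglyMeasurable_tree n fun t => proportion (n + 1) t u)
    (h.integrable_proportion u) ?_
  rintro n _ ⟨S, -, rfl⟩
  have hnn : ∀ m, 0 ≤ᵐ[μ.restrict (history T (n + 1) ⁻¹' S)]
      fun ω => proportion (m + 1) (T (m + 1) ω) u :=
    fun m => ae_of_all _ fun ω => proportion_nonneg _ _ _
  rw [← ENNReal.ofReal_le_ofReal_iff (integral_nonneg_of_ae (hnn (n + 1))),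
    ofReal_integral_eq_lintegral_ofReal (h.integrable_proportion u n).restrict (hnn n),
    ofReal_integral_eq_lintegral_ofReal (h.integrable_proportion u (n + 1)).restrict (hnn (n + 1)),
    h.setLIntegral_step (G := fun t => proportion (n + 1 + 1) t u)
      fun t => proportion_nonneg _ _ _]
  refine lintegral_mono_ae (ae_restrict_of_ae ?_)
  filter_upwards [h.ae_isRecursiveTree] with ω hω
  exact ENNReal.ofReal_le_ofReal (proportion_le_stepMean (hω n) u)

theorem ae_tendsto_proportion (h : IsUniformAttachment μ T V) :
    ∀ᵐ ω ∂μ, ∀ u, Tendsto (fun n => proportion n (T n ω) u) atTop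
      (𝓝 (limitProportion (fun n => T n ω) u)) := by
  refine ae_all_iff.2 fun u => ?_
  have hb : ∀ n, eLpNorm (fun ω => proportion (n + 1) (T (n + 1) ω) u) 1 μ ≤ (1 : NNReal) :=
    fun n => (eLpNorm_le_of_ae_bound (h.ae_norm_proportion_le u n)).trans (by simp)
  filter_upwards [(h.submartingale_proportion u).exists_ae_tendsto_of_bdd hb] with ω ⟨c, hc⟩
  -- `limUnder` is the true limit as soon as one exists.
  exact tendsto_nhds_limUnder ⟨c, (tendsto_add_atTop_iff_nat 1).1 hc⟩

end IsUniformAttachment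

/-! ### The tail of the number of competitors -/

/-- A word outside `t` has proportion 0, and `0 ^ β = 0`, so it contributes nothing. -/
theorem sum_pathProd_le_powerSum {n N : ℕ} {t : Finset Word} (ht : IsRecursiveTree n t) {β : ℝ}
    (hβ : 0 < β) (F : Finset Word) :
    ∑ u ∈ F, pathProd (fun v => proportion N t v ^ β) u ≤ powerSum β N t := by
  have hnn : ∀ u, 0 ≤ pathProd (fun v => proportion N t v ^ β) u :=
    pathProd_nonneg fun v => Real.rpow_nonneg (proportion_nonneg _ _ _) _
  rw [← Finset.sum_filter_of_ne (p := fun u => u ∈ t)]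
  · exact Finset.sum_le_sum_of_subset_of_nonneg (fun u hu => (Finset.mem_filter.1 hu).2)
      fun u _ _ => hnn u
  intro u _ hu
  by_contra hut
  refine hu (pathProd_eq_zero (fun h => hut (h ▸ ht.nil_mem)) ?_)
  simp [proportion, ht.stemmingSubtree_eq_empty hut, hβ.ne']

theorem one_le_rpow_mul_pathProd {x β : ℝ} {f : Word → ℝ} {u : Word} (hx : 0 ≤ x) (hβ : 0 ≤ β)
    (hf : ∀ v, 0 ≤ f v) (hu : u ∈ competitorSet x f) :
    1 ≤ x ^ β * pathProd (fun v => f v ^ β) u := by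
  rw [pathProd_rpow hf, ← Real.mul_rpow hx (pathProd_nonneg hf u)]
  refine Real.one_le_rpow (le_trans hu ?_) hβ
  refine mul_le_mul_of_nonneg_left (Finset.prod_le_prod (fun k _ => ?_) fun k _ => ?_) hx
  · exact div_nonneg (hf _) zero_le_two
  · exact half_le_self (hf _)

/-- Restricting to a finite `F` lets the limit pass through the sum without any uniformity over
words. -/
theorem exp_card_le_liminf {t : ℕ → Finset Word} {f : Word → ℝ}
    (ht : ∀ n, IsRecursiveTree n (t (n + 1)))
    (hf : ∀ u, Tendsto (fun n => proportion n (t n) u) atTop (𝓝 (f u)))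
    {x β l : ℝ} (hx : 0 < x) (hβ : 0 < β) (hl : 0 ≤ l) {F : Finset Word}
    (hF : ∀ u ∈ F, u ∈ competitorSet x f) :
    ENNReal.ofReal (Real.exp (l * (F.card / x ^ β))) ≤
      liminf (fun n => ENNReal.ofReal (Real.exp (l * powerSum β (n + 1) (t (n + 1))))) atTop := by
  have hf0 : ∀ u, 0 ≤ f u := fun u =>
    ge_of_tendsto' (hf u) fun n => proportion_nonneg _ _ _
  have hlim : Tendsto (fun n => ∑ u ∈ F, pathProd (fun v => proportion (n + 1) (t (n + 1)) v ^ β) u)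
      atTop (𝓝 (∑ u ∈ F, pathProd (fun v => f v ^ β) u)) := by
    refine tendsto_finsetSum _ fun u _ => tendsto_finsetProd _ fun k _ => ?_
    exact ((tendsto_add_atTop_iff_nat 1).2 (hf _)).rpow_const (Or.inr hβ.le)
  have hcard : (F.card : ℝ) / x ^ β ≤ ∑ u ∈ F, pathProd (fun v => f v ^ β) u := by
    rw [div_le_iff₀' (Real.rpow_pos_of_pos hx β), Finset.mul_sum, Finset.card_eq_sum_ones,
      Nat.cast_sum]
    exact Finset.sum_le_sum fun u hu => by
      simpa using one_le_rpow_mul_pathProd hx.le hβ.le hf0 (hF u hu)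
  have hlim' := (ENNReal.continuous_ofReal.tendsto _).comp
    ((Real.continuous_exp.tendsto _).comp (hlim.const_mul l))
  calc ENNReal.ofReal (Real.exp (l * (F.card / x ^ β)))
      ≤ ENNReal.ofReal (Real.exp (l * ∑ u ∈ F, pathProd (fun v => f v ^ β) u)) := by gcongr
    _ = liminf _ atTop := hlim'.liminf_eq.symm
    _ ≤ _ := by
      refine liminf_le_liminf (Eventually.of_forall fun n => ?_)
      refine ENNReal.ofReal_le_ofReal (Real.exp_le_exp.2 ?_)
      exact mul_le_mul_of_nonneg_left (sum_pathProd_le_powerSum (ht n) hβ F) hl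

/-- Covers an infinite count as well, so finiteness of `N_x(P)` need not be shown beforehand. -/
theorem exists_finset_of_le_encard {S : Set Word} {r : ℝ}
    (h : ENNReal.ofReal r ≤ (S.encard : ℝ≥0∞)) :
    ∃ F : Finset Word, (∀ u ∈ F, u ∈ S) ∧ r ≤ F.card := by
  by_cases hS : S.Finite
  · refine ⟨hS.toFinset, by simp, ?_⟩
    rw [hS.encard_eq_coe_toFinset_card] at h
    have h' : ENNReal.ofReal r ≤ ENNReal.ofReal (hS.toFinset.card : ℝ) := by simpa using h
    exact (ENNReal.ofReal_le_ofReal_iff (Nat.cast_nonneg _)).1 h'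
  · obtain ⟨F, hF, hcard⟩ := Set.Infinite.exists_subset_card_eq hS ⌈r⌉₊
    exact ⟨F, hF, hcard ▸ Nat.le_ceil r⟩

theorem rpow_le_exp_sqrt_log {x : ℝ} (hx : 1 ≤ x) :
    x ^ (1 / (1 + √(Real.log x))) ≤ Real.exp (√(Real.log x)) := by
  have hs := Real.sqrt_nonneg (Real.log x)
  have hsq := Real.sq_sqrt (Real.log_nonneg hx)
  rw [Real.rpow_def_of_pos (by linarith), Real.exp_le_exp, mul_one_div,
    div_le_iff₀ (by linarith)]
  nlinarith

theorem IsUniformAttachment.measure_competitorCount_ge_le {Ω : Type*} [MeasurableSpace Ω]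
    {μ : Measure Ω} [IsProbabilityMeasure μ] {T : ℕ → Ω → Finset Word} {V : ℕ → Ω → Word}
    (h : IsUniformAttachment μ T V) {x y : ℝ} (hx : 1 ≤ x) (hy : 1 ≤ y) :
    μ {ω | ENNReal.ofReal (y * Real.exp (4 + 4 * √(Real.log x))) ≤
        (competitorCount x (limitProportion (fun n => T n ω)) : ℝ≥0∞)} ≤
      ENNReal.ofReal (2 * Real.exp (-y)) := by
  set s := √(Real.log x) with hs_def
  have hs : 0 ≤ s := Real.sqrt_nonneg _
  set β : ℝ := 1 / (1 + s) with hβ_def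
  have hβ : 0 < β := by positivity
  have hβ1 : β ≤ 1 := by rw [hβ_def, div_le_one (by positivity)]; linarith
  have hxβ : x ^ β ≤ Real.exp s := rpow_le_exp_sqrt_log hx
  have hxβ0 : 0 < x ^ β := Real.rpow_pos_of_pos (by linarith) β
  set l := Real.exp (-(2 / β)) / 3 with hl_def
  have hl : 0 < l := by positivity
  -- Origin of the constant 4: `l = exp (-2 - 2 * s) / 3`, so the right side is `exp (2 + 2 * s) /
  -- 3`, which exceeds `exp s` because `exp 2 ≥ 3`.
  have hlarge : x ^ β ≤ l * Real.exp (4 + 4 * s) := by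
    have h2β : 2 / β = 2 + 2 * s := by rw [hβ_def]; field_simp
    have h3 : (3 : ℝ) ≤ Real.exp 2 := by linarith [Real.add_one_le_exp 2]
    calc x ^ β ≤ Real.exp s := hxβ
      _ ≤ Real.exp 2 / 3 * Real.exp s :=
        le_mul_of_one_le_left (Real.exp_pos _).le ((one_le_div (by norm_num)).2 h3)
      _ ≤ Real.exp 2 / 3 * Real.exp (2 * s) := by gcongr; linarith
      _ = l * Real.exp (4 + 4 * s) := by
        rw [hl_def, h2β, div_mul_eq_mul_div, div_mul_eq_mul_div, ← Real.exp_add, ← Real.exp_add]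
        congr 2
        ring
  set g : ℕ → Ω → ℝ≥0∞ := fun n ω =>
    ENNReal.ofReal (Real.exp (l * powerSum β (n + 1) (T (n + 1) ω))) with hg
  have hgm : ∀ n, Measurable (g n) := fun n =>
    (Measurable.of_discrete (f := fun t : Finset Word =>
      ENNReal.ofReal (Real.exp (l * powerSum β (n + 1) t)))).comp (h.measurable_tree n)
  have hint : ∫⁻ ω, liminf (fun n => g n ω) atTop ∂μ ≤ 2 := by
    refine (lintegral_liminf_le hgm).trans ?_
    refine liminf_le_of_frequently_le' (Eventually.frequently (Eventually.of_forall fun n => ?_))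
    rw [hg, h.lintegral_eq_treeMean (n := n)
      (G := fun t => Real.exp (l * powerSum β (n + 1) t)) fun t => (Real.exp_pos _).le]
    exact (ENNReal.ofReal_le_ofReal (treeMean_exp_powerSum_le_two hβ hβ1 n)).trans (by simp)
  -- An almost sure inclusion into an event on the measurable liminf, to which Markov's inequality
  -- applies.
  have hsub : ∀ᵐ ω ∂μ, ω ∈ {ω | ENNReal.ofReal (y * Real.exp (4 + 4 * s)) ≤
      (competitorCount x (limitProportion (fun n => T n ω)) : ℝ≥0∞)} →
      ω ∈ {ω | ENNReal.ofReal (Real.exp y) ≤ liminf (fun n => g n ω) atTop} := by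
    filter_upwards [h.ae_isRecursiveTree, h.ae_tendsto_proportion] with ω h1 h2 hω
    obtain ⟨F, hF, hcard⟩ := exists_finset_of_le_encard hω
    refine le_trans (ENNReal.ofReal_le_ofReal (Real.exp_le_exp.2 ?_))
      (exp_card_le_liminf (t := fun n => T n ω) h1 h2 (by linarith : 0 < x) hβ hl.le hF)
    rw [← mul_div_assoc, le_div_iff₀ hxβ0]
    calc y * x ^ β ≤ y * (l * Real.exp (4 + 4 * s)) := by gcongr
      _ = l * (y * Real.exp (4 + 4 * s)) := by ring
      _ ≤ l * F.card := by gcongr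
  refine (measure_mono_ae hsub).trans ?_
  refine (meas_ge_le_lintegral_div (Measurable.liminf hgm).aemeasurable
    (by simpa using Real.exp_pos y) ENNReal.ofReal_ne_top).trans ?_
  calc (∫⁻ ω, liminf (fun n => g n ω) atTop ∂μ) / ENNReal.ofReal (Real.exp y)
      ≤ ENNReal.ofReal 2 / ENNReal.ofReal (Real.exp y) := by
        gcongr
        simpa using hint
    _ = ENNReal.ofReal (2 * Real.exp (-y)) := by
        rw [← ENNReal.ofReal_div_of_pos (Real.exp_pos y), Real.exp_neg, div_eq_mul_inv]

end UniformAttachment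

theorem mainTheorem7 :
    ∃ c : ℝ, 0 < c ∧
      ∀ (Ω : Type*) [MeasurableSpace Ω] (μ : Measure Ω) [IsProbabilityMeasure μ]
        (T : ℕ → Ω → Finset UniformAttachment.Word) (V : ℕ → Ω → UniformAttachment.Word),
        UniformAttachment.IsUniformAttachment μ T V →
        (∀ᵐ ω ∂μ, ∀ u : UniformAttachment.Word,
          Tendsto (fun n => UniformAttachment.proportion n (T n ω) u) atTop
            (𝓝 (UniformAttachment.limitProportion (fun n => T n ω) u))) ∧
        ∀ x y : ℝ, 1 ≤ x → 1 ≤ y →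
          μ {ω | ENNReal.ofReal (y * Real.exp (c + c * √(Real.log x))) ≤
              (UniformAttachment.competitorCount x
                (UniformAttachment.limitProportion (fun n => T n ω)) : ℝ≥0∞)} ≤
            ENNReal.ofReal (2 * Real.exp (-y)) := by
  refine ⟨4, by norm_num, fun Ω _ μ _ T V h => ⟨h.ae_tendsto_proportion, fun x y hx hy => ?_⟩⟩
  exact h.measure_competitorCount_ge_le hx hy
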